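/- **Definitions.** An *algebraic frame* is a complete lattice $L$ with $a\wedge\bigvee S=\bigvee\{a\wedge s\mid s\in S\}$ for all $a\in L$, $S\subseteq L$, in which every element is a join of compact elements ($k$ is compact if $k\le\bigvee S$ implies $k\le\bigvee T$ for some finite $T\subseteq S$). Let $\mathsf{AlgFrm_J}$ be the category of algebraic frames and maps preserving arbitrary joins and compact elements. Let $X$ be a Priestley space (a compact ordered space in which $x\not\le y$ implies that some clopen upset contains $x$ and misses $y$), and let $X_0\subseteq X$. Let $\mathcal A(X)$ be the set of clopen upsets $U$ with $\max(X\setminus U)\subseteq X_0$, and let $\mathcal I_x=\{U\in\mathcal A(X)\mid x\notin U\}$. A *pointed generalized Priestley space* is a tuple $\langle X,\tau,\le,X_0,m\rangle$ such that $\langle X,\tau,\le\rangle$ is a Priestley space with maximum $m$; $X_0$ is a dense subset of $X\setminus\{m\}$; each $x\ne m$ lies below some $y\in X_0$; $x\in X_0$ iff $\mathcal I_x$ is nonempty and directed under inclusion; and $x\le y$ iff $x\in U\Rightarrow y\in U$ for all $U\in\mathcal A(X)$. For $R\subseteq X\times Y$ and $U\subseteq Y$ put $R[x]=\{y\mid xRy\}$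 and $\Box_RU=\{x\in X\mid R[x]\subseteq U\}$. A *generalized Priestley morphism* $X\to Y$ is a relation $R\subseteq X\times Y$ such that (1) if not $xRy$, then there is $U\in\mathcal A(Y)$ with $R[x]\subseteq U$ and $y\notin U$; (2) $\Box_RU\in\mathcal A(X)$ for each $U\in\mathcal A(Y)$. Let $\mathsf{PGPS}$ be the category of pointed generalized Priestley spaces and generalized Priestley morphisms, where the identity of $X$ is $\le$ and the composite of $R\subseteq X\times Y$ and $S\subseteq Y\times Z$ is given by $x(S*R)z$ iff $x\in\Box_R\Box_SU\Rightarrow z\in U$ for all $U\in\mathcal A(Z)$. The contravariant functor $\mathcal V^a:\mathsf{PGPS}\to\mathsf{AlgFrm_J}$ sends $X$ to the set of closed upsets $C$ of $X$ with $X\setminus C={\downarrow}(X_0\setminus C)$, ordered by $\supseteq$, and sends $R\subseteq X\times Y$ to $\Box_R:\mathcal V^a(Y)\to\mathcal V^a(X)$. In a complete lattice $L$, $a\ll b$ means that $b\le\bigvee S$ implies $a\le\bigvee T$ for some finite $T\subseteq S$. An element $p\ne1$ is *prime* if $a\wedge b\le p$ implies $a\le p$ or $b\le p$, and *pseudoprime*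 if $a_1\wedge\dots\wedge a_n\ll p$ implies $a_i\le p$ for some $i$. The contravariant functor $\mathcal Y:\mathsf{AlgFrm_J}\to\mathsf{PGPS}$ sends $L$ to $\langle Y_L,\tau,\le,P(L),1\rangle$, where $Y_L$ consists of the pseudoprime elements of $L$ together with $1$, $\le$ is the order of $L$, $P(L)$ is the set of prime elements, and $\tau$ is the restriction to $Y_L$ of the topology on $L$ with subbasis $\{{\uparrow}k\}\cup\{L\setminus{\uparrow}k\}$, $k$ compact. It sends $\alpha:L\to M$ with right adjoint $r$ to $R_\alpha\subseteq Y_M\times Y_L$, where $pR_\alpha q$ iff $r(p)\le q$. **Theorem.** The contravariant functors $\mathcal V^a$ and $\mathcal Y$ are well defined and establish a dual equivalence between $\mathsf{AlgFrm_J}$ and $\mathsf{PGPS}$: they are mutually quasi-inverse, i.e. $\mathcal V^a\circ\mathcal Y$ and $\mathcal Y\circ\mathcal V^a$ are naturally isomorphic to the respective identity functors. -/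

import Mathlib

open CategoryTheory

universe u

/-! ### Relations and admissible upsets -/

/-- `boxRel R U = {x | R[x] ⊆ U}`, the modal box of a relation `R ⊆ X × Y`. -/
def boxRel {X Y : Type u} (R : X → Y → Prop) (U : Set Y) : Set X :=
  {x | ∀ y, R x y → y ∈ U}

/-- `𝒜(X)`: the clopen upsets `U` of an ordered space with distinguished subset `X₀` such that
every maximal element of `X ∖ U` lies in `X₀`. -/
def admClopUp {X : Type u} [TopologicalSpace X] [PartialOrder X] (X₀ : Set X) : Set (Set X) :=
  {U | IsClopen U ∧ IsUpperSet U ∧ ∀ x, Maximal (fun y => y ∈ Uᶜ) x → x ∈ X₀}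

/-- `ℐ_x`: the admissible clopen upsets that miss `x`. -/
def admMissing {X : Type u} [TopologicalSpace X] [PartialOrder X] (X₀ : Set X) (x : X) :
    Set (Set X) :=
  {U | U ∈ admClopUp X₀ ∧ x ∉ U}

theorem priestley_isClosed_Ici {X : Type u} [TopologicalSpace X] [PartialOrder X] [PriestleySpace X] (x : X) : IsClosed (Set.Ici x) := by
  rw [← isOpen_compl_iff, isOpen_iff_forall_mem_open]
  intro y hy
  obtain ⟨U, hU, hup, hx, hyU⟩ := exists_isClopen_upper_of_not_le (hy : ¬ x ≤ y)
  exact ⟨Uᶜ, fun z hz hxz => hz (hup hxz hx), hU.compl.isOpen, hyU⟩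

theorem priestley_exists_maximal {X : Type u} [TopologicalSpace X] [PartialOrder X] [PriestleySpace X] [CompactSpace X]
    {K : Set X} (hK : IsClosed K) {x : X} (hx : x ∈ K) :
    ∃ y, x ≤ y ∧ Maximal (fun z => z ∈ K) y := by
  refine zorn_le_nonempty₀ K ?_ x hx
  intro c hc hchain y hy
  have : (⋂ z : c, (Set.Ici z.1 ∩ K)).Nonempty := by
    have : Nonempty c := ⟨⟨y, hy⟩⟩
    refine IsCompact.nonempty_iInter_of_directed_nonempty_isCompact_isClosed _ ?_ ?_ ?_ ?_
    · rintro ⟨a, ha⟩ ⟨b, hb⟩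
      rcases hchain.total ha hb with h | h
      · exact ⟨⟨b, hb⟩, fun w hw => ⟨le_trans h hw.1, hw.2⟩, fun w hw => hw⟩
      · exact ⟨⟨a, ha⟩, fun w hw => hw, fun w hw => ⟨le_trans h hw.1, hw.2⟩⟩
    · exact fun z => ⟨z.1, le_rfl, hc z.2⟩
    · exact fun z => ((priestley_isClosed_Ici z.1).inter hK).isCompact
    · exact fun z => (priestley_isClosed_Ici z.1).inter hK
  obtain ⟨w, hw⟩ := this
  rw [Set.mem_iInter] at hw
  exact ⟨w, (hw ⟨y, hy⟩).2, fun z hz => (hw ⟨z, hz⟩).1⟩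

/-! ### Pointed generalized Priestley spaces -/

/-- A pointed generalized Priestley space `⟨X, τ, ≤, X₀, m⟩`. -/
structure PGPS : Type (u + 1) where
  carrier : Type u
  [topology : TopologicalSpace carrier]
  [order : PartialOrder carrier]
  [compact : CompactSpace carrier]
  [priestley : PriestleySpace carrier]
  /-- the distinguished subset `X₀` -/
  base : Set carrier
  /-- the distinguished point `m` -/
  pt : carrier
  le_pt : ∀ x, x ≤ pt
  base_subset : base ⊆ {pt}ᶜ
  base_dense : {pt}ᶜ ⊆ closure base
  base_order_dense : ∀ x, x ≠ pt → ∃ y ∈ base, x ≤ y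
  mem_base_iff : ∀ x, x ∈ base ↔
    (admMissing base x).Nonempty ∧ DirectedOn (fun U V => U ⊆ V) (admMissing base x)
  le_iff : ∀ x y, x ≤ y ↔ ∀ U ∈ admClopUp base, x ∈ U → y ∈ U

namespace PGPS

instance : CoeSort PGPS.{u} (Type u) := ⟨PGPS.carrier⟩

attribute [instance] PGPS.topology PGPS.order PGPS.compact PGPS.priestley

/-- The admissible clopen upsets `𝒜(X)` of a pointed generalized Priestley space. -/
def adm (X : PGPS.{u}) : Set (Set X) := admClopUp X.base

end PGPS

/-- A generalized Priestley morphism from `X` to `Y`: a relation `R ⊆ X × Y` such that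
`x` not `R`-related to `y` is witnessed by an admissible clopen upset, and `□_R` sends admissible
clopen upsets to admissible clopen upsets. -/
@[ext]
structure GPMor (X Y : PGPS.{u}) : Type u where
  rel : X → Y → Prop
  sep : ∀ x y, ¬ rel x y → ∃ U ∈ Y.adm, (∀ z, rel x z → z ∈ U) ∧ y ∉ U
  box_mem : ∀ U ∈ Y.adm, boxRel rel U ∈ X.adm

/-- The relation `S * R`. -/
def starRel {X Y Z : PGPS.{u}} (R : X → Y → Prop) (S : Y → Z → Prop) (x : X) (z : Z) : Prop :=
  ∀ U ∈ Z.adm, x ∈ boxRel R (boxRel S U) → z ∈ U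

theorem boxRel_le {X : PGPS.{u}} {U : Set X} (hU : IsUpperSet U) :
    boxRel (fun x y : X => x ≤ y) U = U := by
  ext x
  exact ⟨fun h => h x le_rfl, fun h y hy => hU hy h⟩

theorem boxRel_starRel {X Y Z : PGPS.{u}} (R : X → Y → Prop) (S : Y → Z → Prop) {U : Set Z}
    (hU : U ∈ Z.adm) : boxRel (starRel R S) U = boxRel R (boxRel S U) := by
  ext x
  constructor
  · intro h y hy z hz
    exact h z (fun V _ hx => hx y hy z hz)
  · intro h z hz
    exact hz U hU h

theorem GPMor.ext_box {X Y : PGPS.{u}} {R S : GPMor X Y}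
    (h : ∀ U ∈ Y.adm, boxRel R.rel U = boxRel S.rel U) : R = S := by
  ext x y
  constructor
  · intro hR
    by_contra hS
    obtain ⟨U, hU, h1, h2⟩ := S.sep x y hS
    have : x ∈ boxRel R.rel U := by rw [h U hU]; exact h1
    exact h2 (this y hR)
  · intro hS
    by_contra hR
    obtain ⟨U, hU, h1, h2⟩ := R.sep x y hR
    have : x ∈ boxRel S.rel U := by rw [← h U hU]; exact h1
    exact h2 (this y hS)

/-- The identity morphism is the order relation. -/
def GPMor.id (X : PGPS.{u}) : GPMor X X where
  rel x y := x ≤ y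
  sep x y h := by
    rw [X.le_iff] at h
    push Not at h
    obtain ⟨U, hU, hx, hy⟩ := h
    exact ⟨U, hU, fun z hz => hU.2.1 hz hx, hy⟩
  box_mem U hU := by rw [boxRel_le hU.2.1]; exact hU

/-- The composite `S * R` of `R : X → Y` and `S : Y → Z`. -/
def GPMor.comp {X Y Z : PGPS.{u}} (R : GPMor X Y) (S : GPMor Y Z) : GPMor X Z where
  rel := starRel R.rel S.rel
  sep x z h := by
    unfold starRel at h
    push Not at h
    obtain ⟨U, hU, hx, hz⟩ := h
    exact ⟨U, hU, fun w hw => hw U hU hx, hz⟩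
  box_mem U hU := by
    rw [boxRel_starRel _ _ hU]
    exact R.box_mem _ (S.box_mem _ hU)

/-- The category of pointed generalized Priestley spaces and generalized Priestley morphisms. -/
instance PGPS.category : Category.{u} PGPS.{u} where
  Hom := GPMor
  id := GPMor.id
  comp := GPMor.comp
  id_comp {X Y} R := by
    refine GPMor.ext_box fun U hU => ?_
    exact (boxRel_starRel _ _ hU).trans (boxRel_le (R.box_mem U hU).2.1)
  comp_id {X Y} R := by
    refine GPMor.ext_box fun U hU => ?_
    refine (boxRel_starRel _ _ hU).trans ?_
    exact congrArg (boxRel R.rel) (boxRel_le hU.2.1)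
  assoc {W X Y Z} R S T := by
    refine GPMor.ext_box fun U hU => ?_
    refine (boxRel_starRel _ _ hU).trans ?_
    refine (boxRel_starRel _ _ (T.box_mem U hU)).trans ?_
    refine Eq.symm ((boxRel_starRel _ _ hU).trans ?_)
    exact congrArg (boxRel R.rel) (boxRel_starRel _ _ hU)

/-! ### Algebraic frames -/

/-- An algebraic frame: a frame in which every element is a join of compact elements. -/
structure AlgFrmJ : Type (u + 1) where
  carrier : Type u
  [frame : Order.Frame carrier]
  [algebraic : IsCompactlyGenerated carrier]

namespace AlgFrmJ

instance : CoeSort AlgFrmJ.{u} (Type u) := ⟨AlgFrmJ.carrier⟩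

attribute [instance] AlgFrmJ.frame AlgFrmJ.algebraic

end AlgFrmJ

/-- A map between algebraic frames preserving arbitrary joins and compact elements. -/
@[ext]
structure AlgFrmJHom (L M : AlgFrmJ.{u}) : Type u where
  toFun : L → M
  map_sSup : ∀ S : Set L, toFun (sSup S) = sSup (toFun '' S)
  map_compact : ∀ k : L, IsCompactElement k → IsCompactElement (toFun k)

/-- The category of algebraic frames and maps preserving arbitrary joins and compact elements. -/
instance AlgFrmJ.category : Category.{u} AlgFrmJ.{u} where
  Hom := AlgFrmJHom
  id L := ⟨fun a => a, fun S => by simp, fun _ hk => hk⟩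
  comp α β := ⟨fun a => β.toFun (α.toFun a), fun S => by
    rw [α.map_sSup, β.map_sSup, Set.image_image], fun k hk => β.map_compact _ (α.map_compact k hk)⟩

/-! ### Admissible closed upsets -/

/-- An admissible closed upset of `X`: a closed upset `C` with `X ∖ C = ↓(X₀ ∖ C)`. -/
@[ext]
structure AdmClosedUp (X : PGPS.{u}) : Type u where
  carrier : Set X
  closed : IsClosed carrier
  upper : IsUpperSet carrier
  adm : carrierᶜ = {x | ∃ y ∈ X.base \ carrier, x ≤ y}

namespace AdmClosedUp

variable {X : PGPS.{u}}

/-- Admissible closed upsets are ordered by reverse inclusion. -/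
instance : PartialOrder (AdmClosedUp X) where
  le A B := B.carrier ⊆ A.carrier
  le_refl _ := Set.Subset.rfl
  le_trans _ _ _ h₁ h₂ := Set.Subset.trans h₂ h₁
  le_antisymm _ _ h₁ h₂ := AdmClosedUp.ext (Set.Subset.antisymm h₂ h₁)

theorem le_def {A B : AdmClosedUp X} : A ≤ B ↔ B.carrier ⊆ A.carrier := Iff.rfl

theorem exists_base (C : AdmClosedUp X) {x : X} (hx : x ∉ C.carrier) :
    ∃ y ∈ X.base, y ∉ C.carrier ∧ x ≤ y := by
  have h : x ∈ C.carrierᶜ := hx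
  rw [C.adm] at h
  obtain ⟨y, hy, hxy⟩ := h
  exact ⟨y, hy.1, hy.2, hxy⟩

/-- A constructor that only asks for the nontrivial inclusion. -/
def mk₁ (C : Set X) (hc : IsClosed C) (hu : IsUpperSet C)
    (h : ∀ x, x ∉ C → ∃ y ∈ X.base, y ∉ C ∧ x ≤ y) : AdmClosedUp X where
  carrier := C
  closed := hc
  upper := hu
  adm := by
    ext x
    constructor
    · intro hx
      obtain ⟨y, h1, h2, h3⟩ := h x hx
      exact ⟨y, ⟨h1, h2⟩, h3⟩
    · rintro ⟨y, hy, hxy⟩ hx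
      exact hy.2 (hu hxy hx)

/-- Joins are intersections. -/
instance : SupSet (AdmClosedUp X) where
  sSup 𝒮 := mk₁ (⋂ C ∈ 𝒮, C.carrier) (isClosed_biInter fun C _ => C.closed)
    (isUpperSet_iInter₂ fun C _ => C.upper) (by
      intro x hx
      simp only [Set.mem_iInter, not_forall] at hx
      obtain ⟨C, hC, hx⟩ := hx
      obtain ⟨y, h1, h2, h3⟩ := C.exists_base hx
      exact ⟨y, h1, fun h => h2 (Set.mem_iInter₂.1 h C hC), h3⟩)

theorem mem_sSup {𝒮 : Set (AdmClosedUp X)} {x : X} :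
    x ∈ (sSup 𝒮).carrier ↔ ∀ C ∈ 𝒮, x ∈ C.carrier := Set.mem_iInter₂

theorem isLUB_sSup' (𝒮 : Set (AdmClosedUp X)) : IsLUB 𝒮 (sSup 𝒮) :=
  ⟨fun C hC _ hx => mem_sSup.1 hx C hC, fun _ hB _ hx => mem_sSup.2 fun _ hC => hB hC hx⟩

instance : CompleteLattice (AdmClosedUp X) := completeLatticeOfSup _ isLUB_sSup'

end AdmClosedUp

namespace PGPS

variable {X : PGPS.{u}}

theorem adm_exists_base {U : Set X} (hU : U ∈ X.adm) {x : X} (hx : x ∉ U) :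
    ∃ y ∈ X.base, y ∉ U ∧ x ≤ y := by
  obtain ⟨y, hxy, hy⟩ := priestley_exists_maximal (K := Uᶜ) hU.1.compl.isClosed hx
  exact ⟨y, hU.2.2 y hy, hy.1, hxy⟩

theorem mem_adm_of_exists {U : Set X} (hc : IsClopen U) (hu : IsUpperSet U)
    (h : ∀ x, x ∉ U → ∃ y ∈ X.base, y ∉ U ∧ x ≤ y) : U ∈ X.adm := by
  refine ⟨hc, hu, fun x hx => ?_⟩
  obtain ⟨y, h1, h2, h3⟩ := h x hx.1
  rwa [le_antisymm h3 (hx.2 h2 h3)]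

/-- An admissible clopen upset as an admissible closed upset. -/
def admToClosed {U : Set X} (hU : U ∈ X.adm) : AdmClosedUp X :=
  AdmClosedUp.mk₁ U hU.1.isClosed hU.2.1 fun _ hx => adm_exists_base hU hx

/-- A point of `X₀` outside an admissible closed upset is separated from it by an admissible
clopen upset. -/
theorem exists_adm_of_base (C : AdmClosedUp X) {z : X} (hz : z ∈ X.base) (hzC : z ∉ C.carrier) :
    ∃ U ∈ X.adm, C.carrier ⊆ U ∧ z ∉ U := by
  obtain ⟨⟨U₀, hU₀⟩, hdir⟩ := (X.mem_base_iff z).1 hz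
  have : Nonempty (admMissing X.base z) := ⟨⟨U₀, hU₀⟩⟩
  have := C.closed.isCompact.elim_directed_cover
    (fun U : admMissing X.base z => U.1) (fun U => U.2.1.1.isOpen) ?_ ?_
  · obtain ⟨U, hU⟩ := this
    exact ⟨U.1, U.2.1, hU, U.2.2⟩
  · intro x hx
    have hxz : ¬ x ≤ z := fun h => hzC (C.upper h hx)
    rw [X.le_iff] at hxz
    push Not at hxz
    obtain ⟨U, hU, hxU, hzU⟩ := hxz
    exact Set.mem_iUnion.2 ⟨⟨U, hU, hzU⟩, hxU⟩
  · rintro ⟨U, hU⟩ ⟨V, hV⟩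
    obtain ⟨W, hW, h1, h2⟩ := hdir U hU V hV
    exact ⟨⟨W, hW⟩, h1, h2⟩

theorem exists_adm (C : AdmClosedUp X) {x : X} (hx : x ∉ C.carrier) :
    ∃ U ∈ X.adm, C.carrier ⊆ U ∧ x ∉ U := by
  obtain ⟨z, hz, hzC, hxz⟩ := C.exists_base hx
  obtain ⟨U, hU, h1, h2⟩ := exists_adm_of_base C hz hzC
  exact ⟨U, hU, h1, fun h => h2 (hU.2.1 hxz h)⟩

theorem univ_mem_adm : (Set.univ : Set X) ∈ X.adm :=
  ⟨isClopen_univ, isUpperSet_univ, fun _ hx => (hx.1 trivial).elim⟩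

theorem inter_mem_adm {U V : Set X} (hU : U ∈ X.adm) (hV : V ∈ X.adm) : U ∩ V ∈ X.adm := by
  refine mem_adm_of_exists (hU.1.inter hV.1) (hU.2.1.inter hV.2.1) fun x hx => ?_
  by_cases hxU : x ∈ U
  · obtain ⟨y, h1, h2, h3⟩ := adm_exists_base hV (fun h => hx ⟨hxU, h⟩)
    exact ⟨y, h1, fun h => h2 h.2, h3⟩
  · obtain ⟨y, h1, h2, h3⟩ := adm_exists_base hU hxU
    exact ⟨y, h1, fun h => h2 h.1, h3⟩

end PGPS

namespace AdmClosedUp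

variable {X : PGPS.{u}}

/-- The admissible closed upsets satisfy the join infinite distributive law. -/
instance : Order.Frame (AdmClosedUp X) := Order.Frame.ofMinimalAxioms
  { inf_sSup_le_iSup_inf := by
      intro A 𝒮 x hx
      by_contra hxn
      obtain ⟨y, hy, hyn, hxy⟩ := exists_base _ hxn
      have hyA : y ∉ A.carrier := fun h => hyn ((inf_le_left : A ⊓ sSup 𝒮 ≤ A) h)
      have hyS : y ∉ (sSup 𝒮).carrier := fun h => hyn ((inf_le_right : A ⊓ sSup 𝒮 ≤ sSup 𝒮) h)
      rw [mem_sSup] at hyS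
      push Not at hyS
      obtain ⟨B, hB, hyB⟩ := hyS
      obtain ⟨U, hU, hAU, hyU⟩ := PGPS.exists_adm_of_base A hy hyA
      obtain ⟨V, hV, hBV, hyV⟩ := PGPS.exists_adm_of_base B hy hyB
      obtain ⟨W, hW, hUW, hVW⟩ := ((X.mem_base_iff y).1 hy).2 U ⟨hU, hyU⟩ V ⟨hV, hyV⟩
      have h1 : PGPS.admToClosed hW.1 ≤ A ⊓ B :=
        le_inf (hAU.trans hUW) (hBV.trans hVW)
      have h2 : A ⊓ B ≤ ⨆ b ∈ 𝒮, A ⊓ b := le_iSup₂_of_le B hB le_rfl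
      have hyx : y ∈ (⨆ b ∈ 𝒮, A ⊓ b).carrier := AdmClosedUp.upper _ hxy hx
      exact hW.2 (h1 (h2 hyx)) }

theorem isCompactElement_of_adm {C : AdmClosedUp X} (hC : C.carrier ∈ X.adm) :
    IsCompactElement C := by
  rw [CompleteLattice.isCompactElement_iff_le_of_directed_sSup_le]
  intro 𝒮 hne hdir hle
  have : Nonempty 𝒮 := hne.to_subtype
  by_contra hcon
  push Not at hcon
  have : (⋂ D : 𝒮, (D.1.carrier ∩ C.carrierᶜ)).Nonempty := by
    refine IsCompact.nonempty_iInter_of_directed_nonempty_isCompact_isClosed _ ?_ ?_ ?_ ?_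
    · rintro ⟨A, hA⟩ ⟨B, hB⟩
      obtain ⟨D, hD, h1, h2⟩ := hdir A hA B hB
      exact ⟨⟨D, hD⟩, fun w hw => ⟨h1 hw.1, hw.2⟩, fun w hw => ⟨h2 hw.1, hw.2⟩⟩
    · rintro ⟨A, hA⟩
      obtain ⟨x, hx, hxn⟩ := Set.not_subset.1 (hcon A hA)
      exact ⟨x, hx, hxn⟩
    · exact fun D => (D.1.closed.inter hC.1.compl.isClosed).isCompact
    · exact fun D => D.1.closed.inter hC.1.compl.isClosed
  obtain ⟨x, hx⟩ := this
  rw [Set.mem_iInter] at hx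
  obtain ⟨D₀, hD₀⟩ := hne
  exact (hx ⟨D₀, hD₀⟩).2 (hle (mem_sSup.2 fun D hD => (hx ⟨D, hD⟩).1))

theorem eq_sSup_adm (C : AdmClosedUp X) :
    sSup {D : AdmClosedUp X | D.carrier ∈ X.adm ∧ D ≤ C} = C := by
  refine le_antisymm (sSup_le fun D hD => hD.2) fun x hx => ?_
  by_contra hxC
  obtain ⟨U, hU, h1, h2⟩ := PGPS.exists_adm C hxC
  exact h2 (mem_sSup.1 hx (PGPS.admToClosed hU) ⟨hU, h1⟩)

instance : IsCompactlyGenerated (AdmClosedUp X) where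
  exists_sSup_eq C := ⟨_, fun _ hD => isCompactElement_of_adm hD.1, eq_sSup_adm C⟩

/-- The compact elements are exactly the admissible clopen upsets. -/
theorem isCompactElement_iff {C : AdmClosedUp X} : IsCompactElement C ↔ C.carrier ∈ X.adm := by
  refine ⟨fun hC => ?_, isCompactElement_of_adm⟩
  rw [CompleteLattice.isCompactElement_iff_le_of_directed_sSup_le] at hC
  obtain ⟨D, hD, hCD⟩ := hC {D | D.carrier ∈ X.adm ∧ D ≤ C}
    ⟨PGPS.admToClosed PGPS.univ_mem_adm, PGPS.univ_mem_adm, fun _ _ => trivial⟩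
    (fun A hA B hB => ⟨PGPS.admToClosed (PGPS.inter_mem_adm hA.1 hB.1),
      ⟨PGPS.inter_mem_adm hA.1 hB.1, fun x hx => ⟨hA.2 hx, hB.2 hx⟩⟩,
      fun x hx => hx.1, fun x hx => hx.2⟩)
    (eq_sSup_adm C).ge
  rw [le_antisymm hCD hD.2]
  exact hD.1

end AdmClosedUp

/-! ### The functor `𝒱ᵃ` -/

theorem boxRel_closed_iff {X Y : PGPS.{u}} (R : GPMor X Y) (C : AdmClosedUp Y) (x : X) :
    x ∈ boxRel R.rel C.carrier ↔ ∀ U ∈ Y.adm, C.carrier ⊆ U → x ∈ boxRel R.rel U := by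
  constructor
  · intro h U _ hCU y hy
    exact hCU (h y hy)
  · intro h y hy
    by_contra hyC
    obtain ⟨U, hU, h1, h2⟩ := PGPS.exists_adm C hyC
    exact h2 (h U hU h1 y hy)

/-- `□_R C` for an admissible closed upset `C`. -/
def boxClosed {X Y : PGPS.{u}} (R : GPMor X Y) (C : AdmClosedUp Y) : AdmClosedUp X :=
  AdmClosedUp.mk₁ (boxRel R.rel C.carrier)
    (by
      have : boxRel R.rel C.carrier =
          ⋂ U : {U : Set Y // U ∈ Y.adm ∧ C.carrier ⊆ U}, boxRel R.rel U.1 := by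
        ext x
        rw [boxRel_closed_iff, Set.mem_iInter]
        exact ⟨fun h U => h U.1 U.2.1 U.2.2, fun h U hU hC => h ⟨U, hU, hC⟩⟩
      rw [this]
      exact isClosed_iInter fun U => (R.box_mem U.1 U.2.1).1.isClosed)
    (by
      intro x x' hxx' hx
      rw [boxRel_closed_iff] at hx ⊢
      exact fun U hU hC => (R.box_mem U hU).2.1 hxx' (hx U hU hC))
    (by
      intro x hx
      rw [boxRel_closed_iff] at hx
      push Not at hx
      obtain ⟨U, hU, hC, hxU⟩ := hx
      obtain ⟨y, h1, h2, h3⟩ := PGPS.adm_exists_base (R.box_mem U hU) hxU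
      exact ⟨y, h1, fun h => h2 fun z hz => hC (h z hz), h3⟩)

/-- `𝒱ᵃ(X)`: the admissible closed upsets of `X` ordered by reverse inclusion. -/
def VaObj (X : PGPS.{u}) : AlgFrmJ.{u} := ⟨AdmClosedUp X⟩

/-- `𝒱ᵃ(R) = □_R`. -/
def VaMap {X Y : PGPS.{u}} (R : GPMor X Y) : AlgFrmJHom (VaObj Y) (VaObj X) where
  toFun := boxClosed R
  map_sSup 𝒮 := by
    refine AdmClosedUp.ext (Set.ext fun x => ?_)
    refine Iff.trans ?_ AdmClosedUp.mem_sSup.symm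
    constructor
    · rintro h _ ⟨C, hC, rfl⟩ y hy
      exact AdmClosedUp.mem_sSup.1 (h y hy) C hC
    · intro h y hy
      exact AdmClosedUp.mem_sSup.2 fun C hC => h _ ⟨C, hC, rfl⟩ y hy
  map_compact C hC :=
    AdmClosedUp.isCompactElement_iff.2 (R.box_mem _ (AdmClosedUp.isCompactElement_iff.1 hC))

/-- The contravariant functor `𝒱ᵃ : PGPS → AlgFrm_J`. -/
def Va : PGPS.{u}ᵒᵖ ⥤ AlgFrmJ.{u} where
  obj X := VaObj X.unop
  map R := VaMap R.unop
  map_id X := by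
    refine AlgFrmJHom.ext (funext fun C => AdmClosedUp.ext ?_)
    exact boxRel_le (AdmClosedUp.upper C)
  map_comp {X Y Z} R S := by
    refine AlgFrmJHom.ext (funext fun C => AdmClosedUp.ext (Set.ext fun x => ?_))
    change x ∈ boxRel (GPMor.comp S.unop R.unop).rel (AdmClosedUp.carrier C) ↔
      x ∈ boxRel S.unop.rel (boxClosed R.unop C).carrier
    constructor
    · intro h y hy z hz
      exact h z fun U _ hx => hx y hy z hz
    · intro h z hz
      by_contra hzC
      obtain ⟨U, hU, h1, h2⟩ := PGPS.exists_adm C hzC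
      exact h2 (hz U hU fun y hy w hw => h1 (h y hy w hw))

/-! ### Prime and pseudoprime elements -/

/-- The way below relation `a ≪ b`. -/
def WayBelow {L : Type u} [CompleteLattice L] (a b : L) : Prop :=
  ∀ S : Set L, b ≤ sSup S → ∃ T : Set L, T.Finite ∧ T ⊆ S ∧ a ≤ sSup T

/-- A pseudoprime element: `p ≠ 1`, and `a₁ ∧ ⋯ ∧ aₙ ≪ p` implies `aᵢ ≤ p` for some `i`. -/
def PseudoPrime {L : Type u} [CompleteLattice L] (p : L) : Prop :=
  p ≠ ⊤ ∧ ∀ s : Finset L, WayBelow (s.inf id) p → ∃ a ∈ s, a ≤ p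

/-- The topology on `L` with subbasis `{↑k} ∪ {(↑l)ᶜ}`, where `k`, `l` range over the compact
elements. -/
abbrev compactTopology (L : Type u) [CompleteLattice L] : TopologicalSpace L :=
  TopologicalSpace.generateFrom
    ({U | ∃ k : L, IsCompactElement k ∧ U = Set.Ici k} ∪
      {U | ∃ l : L, IsCompactElement l ∧ U = (Set.Ici l)ᶜ})

/-- The underlying set of `𝒴(L)`: the pseudoprime elements of `L` together with `1`. -/
def YSet (L : AlgFrmJ.{u}) : Type u := {a : L // PseudoPrime a ∨ a = ⊤}

namespace YSet

variable {L : AlgFrmJ.{u}}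

instance : PartialOrder (YSet L) := inferInstanceAs (PartialOrder {a : L // PseudoPrime a ∨ a = ⊤})

instance : TopologicalSpace (YSet L) :=
  TopologicalSpace.induced (fun a => a.1) (compactTopology L)

theorem le_def {a b : YSet L} : a ≤ b ↔ a.1 ≤ b.1 := Iff.rfl

/-- `↑a ∩ Y_L`. -/
def up (a : L) : Set (YSet L) := {y | a ≤ y.1}

theorem mem_up {a : L} {y : YSet L} : y ∈ up a ↔ a ≤ y.1 := Iff.rfl

/-- The set of prime elements, as a subset of `Y_L`. -/
def primes (L : AlgFrmJ.{u}) : Set (YSet L) := {y | InfPrime y.1}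

theorem isClopen_up {k : L} (hk : IsCompactElement k) : IsClopen (up k) := by
  constructor
  · rw [← isOpen_compl_iff]
    refine ⟨(Set.Ici k)ᶜ, ?_, rfl⟩
    exact TopologicalSpace.isOpen_generateFrom_of_mem (Or.inr ⟨k, hk, rfl⟩)
  · refine ⟨Set.Ici k, ?_, rfl⟩
    exact TopologicalSpace.isOpen_generateFrom_of_mem (Or.inl ⟨k, hk, rfl⟩)

theorem isUpperSet_up (a : L) : IsUpperSet (up a) := fun _ _ h ha => le_trans ha h

theorem exists_compact {a b : L} (h : ¬ a ≤ b) : ∃ k, IsCompactElement k ∧ k ≤ a ∧ ¬ k ≤ b := by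
  by_contra hcon
  push Not at hcon
  exact h (le_iff_compact_le_imp.2 hcon)

theorem exists_prime {a b : L} (h : ¬ a ≤ b) : ∃ p : L, InfPrime p ∧ b ≤ p ∧ ¬ a ≤ p := by
  obtain ⟨k, hk, hka, hkb⟩ := exists_compact h
  rw [CompleteLattice.isCompactElement_iff_le_of_directed_sSup_le] at hk
  obtain ⟨p, hbp, hp⟩ := zorn_le_nonempty₀ {x : L | ¬ k ≤ x} (by
    intro c hc hchain y hy
    refine ⟨sSup c, fun hkc => ?_, fun z hz => le_sSup hz⟩
    obtain ⟨x, hx, hkx⟩ := hk c ⟨y, hy⟩ hchain.directedOn hkc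
    exact hc hx hkx) b hkb
  refine ⟨p, ⟨?_, ?_⟩, hbp, fun hap => hp.1 (hka.trans hap)⟩
  · intro hmax
    exact hp.1 (by rw [hmax.eq_top]; exact le_top)
  · intro x y hxy
    by_contra hcon
    push Not at hcon
    have key : ∀ z : L, ¬ z ≤ p → k ≤ p ⊔ z := by
      intro z hz
      by_contra hkz
      exact hz (le_sup_right.trans (hp.2 (y := p ⊔ z) hkz le_sup_left))
    have := le_inf (key x hcon.1) (key y hcon.2)
    rw [← sup_inf_left, sup_eq_left.2 hxy] at this
    exact hp.1 this

theorem wayBelow_of_compact {a t b : L} (ht : IsCompactElement t) (hat : a ≤ t) (htb : t ≤ b) :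
    WayBelow a b := by
  intro S hS
  rw [CompleteLattice.isCompactElement_iff_exists_le_sSup_of_le_sSup] at ht
  obtain ⟨T, hT, h⟩ := ht S (htb.trans hS)
  exact ⟨T, T.finite_toSet, hT, hat.trans (h.trans (by rw [Finset.sup_id_eq_sSup]))⟩

theorem exists_compact_of_wayBelow {a b : L} (h : WayBelow a b) :
    ∃ t, IsCompactElement t ∧ a ≤ t ∧ t ≤ b := by
  obtain ⟨T, hT, hTS, haT⟩ := h {c | IsCompactElement c ∧ c ≤ b} (sSup_compact_le_eq b).ge
  refine ⟨hT.toFinset.sup id, ?_, ?_, ?_⟩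
  · exact CompleteLattice.isCompactElement_finsetSup _ fun x hx => (hTS (hT.mem_toFinset.1 hx)).1
  · rw [Finset.sup_id_eq_sSup]; simpa using haT
  · exact Finset.sup_le fun x hx => (hTS (hT.mem_toFinset.1 hx)).2

theorem pseudoPrime_of_infPrime {p : L} (hp : InfPrime p) : PseudoPrime p := by
  refine ⟨fun h => hp.1 (h ▸ isMax_top), fun s hs => ?_⟩
  obtain ⟨t, _, h1, h2⟩ := exists_compact_of_wayBelow hs
  exact hp.finset_inf_le.1 (h1.trans h2)

/-- A prime element as a point of `Y_L`. -/
def ofPrime {p : L} (hp : InfPrime p) : YSet L := ⟨p, Or.inl (pseudoPrime_of_infPrime hp)⟩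

/-- The point `1` of `Y_L`. -/
def one (L : AlgFrmJ.{u}) : YSet L := ⟨⊤, Or.inr rfl⟩

theorem nhds_eq (y : YSet L) (F : Filter (YSet L))
    (h : ∀ k : L, IsCompactElement k → (k ≤ y.1 → up k ∈ F) ∧ (¬ k ≤ y.1 → (up k)ᶜ ∈ F)) :
    F ≤ nhds y := by
  have : nhds y = Filter.comap (fun a : YSet L => a.1) (@nhds L (compactTopology L) y.1) :=
    @nhds_induced _ _ (compactTopology L) _ _
  rw [this, compactTopology, TopologicalSpace.nhds_generateFrom]
  rw [← Filter.map_le_iff_le_comap]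
  refine le_iInf₂ fun U hU => ?_
  rw [Filter.le_principal_iff]
  rcases hU with ⟨hyU, ⟨k, hk, rfl⟩ | ⟨k, hk, rfl⟩⟩
  · exact (h k hk).1 hyU
  · exact (h k hk).2 hyU

theorem exists_finset_inf_compact (s : Finset L) (a : L) (h : ∀ b ∈ s, ¬ b ≤ a) :
    ∃ t : Finset L, (∀ k ∈ t, IsCompactElement k ∧ ¬ k ≤ a) ∧ t.inf id ≤ s.inf id := by
  classical
  induction s using Finset.induction_on with
  | empty => exact ⟨∅, by simp, le_rfl⟩
  | insert b s _ ih =>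
    obtain ⟨t, ht, hts⟩ := ih fun c hc => h c (Finset.mem_insert_of_mem hc)
    obtain ⟨k, hk, hkb, hka⟩ := exists_compact (h b (Finset.mem_insert_self b s))
    refine ⟨insert k t, ?_, ?_⟩
    · intro c hc
      rcases Finset.mem_insert.1 hc with rfl | hc
      · exact ⟨hk, hka⟩
      · exact ht c hc
    · rw [Finset.inf_insert, Finset.inf_insert]
      exact inf_le_inf hkb hts

instance : CompactSpace (YSet L) := by
  refine ⟨isCompact_iff_ultrafilter_le_nhds.2 fun F _ => ?_⟩
  set a : L := sSup {k : L | IsCompactElement k ∧ up k ∈ F} with ha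
  have hmem : ∀ k : L, IsCompactElement k → (k ≤ a ↔ up k ∈ F) := by
    intro k hk
    refine ⟨fun hka => ?_, fun h => le_sSup ⟨hk, h⟩⟩
    rw [CompleteLattice.isCompactElement_iff_exists_le_sSup_of_le_sSup] at hk
    obtain ⟨T, hT, hkT⟩ := hk _ hka
    have : (⋂ t ∈ T, up t) ∈ F := (Filter.biInter_finset_mem T).2 fun t ht => (hT ht).2
    refine Filter.mem_of_superset this fun y hy => ?_
    rw [Set.mem_iInter₂] at hy
    exact hkT.trans (Finset.sup_le fun t ht => hy t ht)
  have hmem' : ∀ k : L, IsCompactElement k → ¬ k ≤ a → (up k)ᶜ ∈ F := fun k hk hka =>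
    Ultrafilter.compl_mem_iff_notMem.2 fun h => hka ((hmem k hk).2 h)
  have haY : PseudoPrime a ∨ a = ⊤ := by
    by_cases htop : a = ⊤
    · exact Or.inr htop
    refine Or.inl ⟨htop, fun s hs => ?_⟩
    by_contra hcon
    push Not at hcon
    obtain ⟨t, hta, hst, hta'⟩ := exists_compact_of_wayBelow hs
    obtain ⟨T, hT, hTs⟩ := exists_finset_inf_compact s a hcon
    have h1 : up t ∈ F := (hmem t hta).1 hta'
    have h2 : (⋂ k ∈ T, (up k)ᶜ) ∈ F :=
      (Filter.biInter_finset_mem T).2 fun k hk => hmem' k (hT k hk).1 (hT k hk).2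
    have h3 : ∃ k, IsCompactElement k ∧ ¬ k ≤ a := by
      obtain ⟨k, hk, _, hka⟩ := exists_compact (a := (⊤ : L)) (b := a)
        (fun h => htop (top_le_iff.1 h))
      exact ⟨k, hk, hka⟩
    obtain ⟨k₀, hk₀, hk₀a⟩ := h3
    obtain ⟨y, ⟨hy1, hy2⟩, hy3⟩ := Ultrafilter.nonempty_of_mem
      (Filter.inter_mem (Filter.inter_mem h1 h2) (hmem' k₀ hk₀ hk₀a))
    rw [Set.mem_iInter₂] at hy2
    rcases y.2 with hy | hy
    · obtain ⟨k, hk, hky⟩ := hy.2 T (wayBelow_of_compact hta (hTs.trans hst) hy1)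
      exact hy2 k hk hky
    · exact hy3 (by rw [mem_up, hy]; exact le_top)
  exact ⟨⟨a, haY⟩, trivial, nhds_eq _ _ fun k hk => ⟨(hmem k hk).1, hmem' k hk⟩⟩

instance : PriestleySpace (YSet L) where
  priestley {x y} h := by
    obtain ⟨k, hk, hkx, hky⟩ := exists_compact (a := x.1) (b := y.1) h
    exact ⟨up k, isClopen_up hk, isUpperSet_up k, hkx, hky⟩

theorem up_mem_adm {k : L} (hk : IsCompactElement k) : up k ∈ admClopUp (primes L) := by
  refine ⟨isClopen_up hk, isUpperSet_up k, fun x hx => ?_⟩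
  obtain ⟨p, hp, hxp, hkp⟩ := exists_prime (a := k) (b := x.1) hx.1
  have h : x = ofPrime hp := le_antisymm hxp (hx.2 (y := ofPrime hp) hkp hxp)
  rw [h]
  exact hp

theorem exists_compact_up_subset {U : Set (YSet L)} (hU : IsClopen U) {a : L}
    (ha : up a ⊆ U) : ∃ k, IsCompactElement k ∧ k ≤ a ∧ up k ⊆ U := by
  classical
  obtain ⟨T, hT⟩ := hU.compl.isClosed.isCompact.elim_finite_subcover
    (fun k : {k : L // IsCompactElement k ∧ k ≤ a} => (up k.1)ᶜ)
    (fun k => (isClopen_up k.2.1).compl.isOpen) (by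
      intro y hy
      obtain ⟨k, hk, hka, hky⟩ := exists_compact (a := a) (b := y.1) fun h => hy (ha h)
      exact Set.mem_iUnion.2 ⟨⟨k, hk, hka⟩, hky⟩)
  refine ⟨T.sup fun k => k.1, CompleteLattice.isCompactElement_finsetSup _ fun k _ => k.2.1,
    Finset.sup_le fun k _ => k.2.2, fun y hy => ?_⟩
  by_contra hyU
  obtain ⟨k, hk, hky⟩ := Set.mem_iUnion₂.1 (hT hyU)
  exact hky (le_trans (Finset.le_sup (f := fun k : {k : L // IsCompactElement k ∧ k ≤ a} => k.1) hk) hy)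

theorem up_subset_iff {a b : L} : up a ⊆ up b ↔ b ≤ a := by
  refine ⟨fun h => ?_, fun h y hy => le_trans h hy⟩
  by_contra hba
  obtain ⟨p, hp, hap, hbp⟩ := exists_prime hba
  exact hbp (h (show ofPrime hp ∈ up a from hap))

theorem adm_iff {U : Set (YSet L)} :
    U ∈ admClopUp (primes L) ↔ ∃ k, IsCompactElement k ∧ U = up k := by
  classical
  refine ⟨fun hU => ?_, by rintro ⟨k, hk, rfl⟩; exact up_mem_adm hk⟩
  obtain ⟨T, hT⟩ := hU.1.isClosed.isCompact.elim_finite_subcover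
    (fun k : {k : L // IsCompactElement k ∧ up k ⊆ U} => up k.1)
    (fun k => (isClopen_up k.2.1).isOpen) (by
      intro y hy
      obtain ⟨k, hk, hky, hkU⟩ := exists_compact_up_subset hU.1 (a := y.1)
        fun z hz => hU.2.1 hz hy
      exact Set.mem_iUnion.2 ⟨⟨k, hk, hkU⟩, hky⟩)
  have hsub : up (T.inf fun k => k.1) ⊆ U := by
    intro q hq
    by_contra hqU
    obtain ⟨p, hqp, hp⟩ := priestley_exists_maximal (K := Uᶜ) hU.1.compl.isClosed hqU
    have hpp : InfPrime p.1 := hU.2.2 p hp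
    obtain ⟨k, _, hkp⟩ := hpp.finset_inf_le.1 (le_trans hq hqp)
    exact hp.1 (k.2.2 hkp)
  obtain ⟨k, hk, hkc, hkU⟩ := exists_compact_up_subset hU.1 hsub
  refine ⟨k, hk, Set.Subset.antisymm (fun y hy => ?_) hkU⟩
  obtain ⟨l, hl, hly⟩ := Set.mem_iUnion₂.1 (hT hy)
  exact hkc.trans (le_trans (Finset.inf_le hl) hly)

theorem mem_closure_primes (q : YSet L) (hq : q ≠ one L) : q ∈ closure (primes L) := by
  classical
  have hqp : PseudoPrime q.1 := q.2.resolve_right fun h => hq (Subtype.ext h)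
  have hex : ∀ i : Finset {k : L // IsCompactElement k ∧ k ≤ q.1} ×
      Finset {l : L // IsCompactElement l ∧ ¬ l ≤ q.1},
      ∃ p : YSet L, InfPrime p.1 ∧ (∀ k ∈ i.1, k.1 ≤ p.1) ∧ ∀ l ∈ i.2, ¬ l.1 ≤ p.1 := by
    rintro ⟨s, t⟩
    have hk : IsCompactElement (s.sup fun k => k.1) :=
      CompleteLattice.isCompactElement_finsetSup _ fun k _ => k.2.1
    have hkq : (s.sup fun k => k.1) ≤ q.1 := Finset.sup_le fun k _ => k.2.2
    have hnle : ¬ (t.image fun l => l.1).inf id ≤ s.sup fun k => k.1 := by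
      intro h
      obtain ⟨a, ha, haq⟩ := hqp.2 _ (wayBelow_of_compact hk h hkq)
      obtain ⟨l, _, rfl⟩ := Finset.mem_image.1 ha
      exact l.2.2 haq
    obtain ⟨p, hp, hkp, hlp⟩ := exists_prime hnle
    refine ⟨ofPrime hp, hp, fun k hks => ?_, fun l hl hle => hlp ?_⟩
    · exact le_trans (Finset.le_sup (f := fun k : {k : L // IsCompactElement k ∧ k ≤ q.1} => k.1)
        hks) hkp
    · exact (Finset.inf_le (f := id) (Finset.mem_image_of_mem _ hl)).trans hle
  choose p hp h1 h2 using hex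
  refine mem_closure_of_tendsto (f := p) (b := Filter.atTop) ?_
    (Filter.Eventually.of_forall fun i => hp i)
  refine nhds_eq q _ fun k hk => ⟨fun hkq => ?_, fun hkq => ?_⟩
  · rw [Filter.mem_map]
    filter_upwards [Filter.eventually_ge_atTop
      (({⟨k, hk, hkq⟩}, ∅) : Finset {k : L // IsCompactElement k ∧ k ≤ q.1} ×
      Finset {l : L // IsCompactElement l ∧ ¬ l ≤ q.1})] with i hi
    exact h1 i _ (hi.1 (Finset.mem_singleton_self _))
  · rw [Filter.mem_map]
    filter_upwards [Filter.eventually_ge_atTop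
      ((∅, {⟨k, hk, hkq⟩}) : Finset {k : L // IsCompactElement k ∧ k ≤ q.1} ×
      Finset {l : L // IsCompactElement l ∧ ¬ l ≤ q.1})] with i hi
    exact h2 i _ (hi.2 (Finset.mem_singleton_self _))

end YSet

/-! ### The functor `𝒴` -/

/-- `𝒴(L) = ⟨Y_L, τ, ≤, P(L), 1⟩`. -/
def YObj (L : AlgFrmJ.{u}) : PGPS.{u} where
  carrier := YSet L
  base := YSet.primes L
  pt := YSet.one L
  le_pt x := (le_top : x.1 ≤ ⊤)
  base_subset x hx h := hx.1 (by rw [h]; exact isMax_top)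
  base_dense q hq := YSet.mem_closure_primes q hq
  base_order_dense x hx := by
    obtain ⟨p, hp, hxp, _⟩ := YSet.exists_prime (a := (⊤ : L)) (b := x.1)
      fun h => hx (Subtype.ext (top_le_iff.1 h))
    exact ⟨YSet.ofPrime hp, hp, hxp⟩
  mem_base_iff a := by
    constructor
    · intro ha
      constructor
      · obtain ⟨k, hk, _, hka⟩ := YSet.exists_compact (a := (⊤ : L)) (b := a.1)
          fun h => ha.1 (by rw [top_le_iff.1 h]; exact isMax_top)
        exact ⟨YSet.up k, YSet.up_mem_adm hk, hka⟩
      · rintro U ⟨hU, haU⟩ V ⟨hV, haV⟩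
        obtain ⟨k, hk, rfl⟩ := YSet.adm_iff.1 hU
        obtain ⟨l, hl, rfl⟩ := YSet.adm_iff.1 hV
        obtain ⟨t, ht, htkl, hta⟩ := YSet.exists_compact (a := k ⊓ l) (b := a.1)
          fun h => (ha.2 h).elim haU haV
        exact ⟨YSet.up t, ⟨YSet.up_mem_adm ht, hta⟩,
          fun y hy => htkl.trans (inf_le_left.trans hy),
          fun y hy => htkl.trans (inf_le_right.trans hy)⟩
    · rintro ⟨⟨U, hU, haU⟩, hdir⟩
      refine ⟨fun h => ?_, fun x y hxy => ?_⟩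
      · obtain ⟨k, hk, rfl⟩ := YSet.adm_iff.1 hU
        exact haU (by rw [YSet.mem_up, h.eq_top]; exact le_top)
      · by_contra hcon
        push Not at hcon
        obtain ⟨k, hk, hkx, hka⟩ := YSet.exists_compact hcon.1
        obtain ⟨l, hl, hly, hla⟩ := YSet.exists_compact hcon.2
        obtain ⟨W, ⟨hW, haW⟩, hkW, hlW⟩ := hdir (YSet.up k) ⟨YSet.up_mem_adm hk, hka⟩
          (YSet.up l) ⟨YSet.up_mem_adm hl, hla⟩
        obtain ⟨t, ht, rfl⟩ := YSet.adm_iff.1 hW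
        exact haW (le_trans (le_inf (YSet.up_subset_iff.1 hkW) (YSet.up_subset_iff.1 hlW))
          (le_trans (inf_le_inf hkx hly) hxy))
  le_iff x y := by
    constructor
    · intro h U hU hx
      exact hU.2.1 h hx
    · intro h
      by_contra hxy
      obtain ⟨k, hk, hkx, hky⟩ := YSet.exists_compact (a := x.1) (b := y.1) hxy
      exact hky (h (YSet.up k) (YSet.up_mem_adm hk) hkx)

/-- The right adjoint of an `AlgFrm_J`-morphism. -/
def AlgFrmJHom.rightAdj {L M : AlgFrmJ.{u}} (α : AlgFrmJHom L M) (b : M) : L :=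
  sSup {a | α.toFun a ≤ b}

theorem AlgFrmJHom.gc {L M : AlgFrmJ.{u}} (α : AlgFrmJHom L M) :
    GaloisConnection α.toFun α.rightAdj := by
  have hmono : Monotone α.toFun := by
    intro a b hab
    have h := α.map_sSup {a, b}
    rw [Set.image_pair, sSup_pair, sSup_pair, sup_eq_right.2 hab] at h
    rw [h]
    exact le_sup_left
  intro a b
  refine ⟨fun h => le_sSup h, fun h => (hmono h).trans ?_⟩
  rw [AlgFrmJHom.rightAdj, α.map_sSup]
  refine sSup_le ?_
  rintro _ ⟨c, hc, rfl⟩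
  exact hc

/-- `p R_α q` iff `r(p) ≤ q`, where `r` is the right adjoint of `α`. -/
def YRel {L M : AlgFrmJ.{u}} (α : AlgFrmJHom L M) (p : YObj M) (q : YObj L) : Prop :=
  α.rightAdj p.1 ≤ q.1

theorem boxRel_YRel {L M : AlgFrmJ.{u}} (α : AlgFrmJHom L M) (k : L) :
    boxRel (YRel α) (YSet.up k) = YSet.up (α.toFun k) := by
  ext p
  constructor
  · intro h
    by_contra hp
    obtain ⟨q, hq, hpq, hkq⟩ := YSet.exists_prime (a := k) (b := α.rightAdj p.1)
      fun h' => hp ((α.gc _ _).2 h')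
    exact hkq (h (YSet.ofPrime hq) hpq)
  · intro h q hq
    exact le_trans ((α.gc _ _).1 h) hq

/-- `𝒴(α) = R_α`. -/
def YMap {L M : AlgFrmJ.{u}} (α : AlgFrmJHom L M) : GPMor (YObj M) (YObj L) where
  rel := YRel α
  sep p q h := by
    obtain ⟨k, hk, hkp, hkq⟩ := YSet.exists_compact h
    exact ⟨YSet.up k, YSet.up_mem_adm hk, fun z hz => le_trans hkp hz, hkq⟩
  box_mem U hU := by
    obtain ⟨k, hk, rfl⟩ := YSet.adm_iff.1 hU
    rw [boxRel_YRel]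
    exact YSet.up_mem_adm (α.map_compact k hk)

/-- The contravariant functor `𝒴 : AlgFrm_J → PGPS`. -/
def Yfun : AlgFrmJ.{u}ᵒᵖ ⥤ PGPS.{u} where
  obj L := YObj L.unop
  map α := YMap α.unop
  map_id L := by
    refine GPMor.ext_box fun U hU => ?_
    obtain ⟨k, hk, rfl⟩ := YSet.adm_iff.1 hU
    exact (boxRel_YRel _ k).trans (boxRel_le (X := YObj L.unop) (YSet.isUpperSet_up k)).symm
  map_comp {L M N} α β := by
    refine GPMor.ext_box fun U hU => ?_
    refine Eq.symm ((boxRel_starRel _ _ hU).trans ?_)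
    obtain ⟨k, hk, rfl⟩ := YSet.adm_iff.1 hU
    refine (congrArg (boxRel _) (boxRel_YRel β.unop k)).trans ?_
    exact (boxRel_YRel α.unop _).trans (boxRel_YRel (α ≫ β).unop k).symm

/-! ### The duality

The functor `𝒱ᵃ` is fully faithful: a join-preserving map `f` between lattices of admissible closed
upsets is `□_R` for the relation `R` whose section `R[x]` is the intersection of all `C` with
`x ∈ f(C)`. The map `a ↦ ↑a ∩ Y_L` is an isomorphism of `L` onto `𝒱ᵃ(𝒴(L))`: it reflects the order
because primes separate elements, and it is onto because the admissible clopen upsets of `𝒴(L)` are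
the sets `↑k ∩ Y_L` with `k` compact. It is natural because `□_{R_α}` sends `↑a` to `↑α(a)`. Hence
`𝒱ᵃ ∘ 𝒴 ≅ 1`, and cancelling the fully faithful `𝒱ᵃ` in `𝒱ᵃ ∘ 𝒴 ∘ 𝒱ᵃ ≅ 𝒱ᵃ` gives `𝒴 ∘ 𝒱ᵃ ≅ 1`. -/

section FullyFaithful

open Functor

/-- The equivalence between a fully faithful functor `G` and a right inverse `F` of `G` up to
isomorphism. It is oriented so that `F` is its functor and `G` its inverse. -/
def equivalenceOfFullyFaithful {C D : Type*} [Category* C] [Category* D] {F : C ⥤ D} {G : D ⥤ C}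
    (hG : G.FullyFaithful) (e : F ⋙ G ≅ 𝟭 C) : C ≌ D :=
  .mk F G e.symm <| (hG.whiskeringRight D).preimageIso <|
    associator G F G ≪≫ isoWhiskerLeft G e ≪≫ G.rightUnitor ≪≫ G.leftUnitor.symm

end FullyFaithful

theorem isCompactElement_map_orderIso {L M : Type*} [PartialOrder L] [PartialOrder M] (e : L ≃o M)
    {k : L} (hk : IsCompactElement k) : IsCompactElement (e k) := by
  intro S b hne hdir hb hkb
  obtain ⟨_, ⟨x, hx, rfl⟩, hkx⟩ := hk (e.symm '' S) (e.symm b) (hne.image _)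
    (directedOn_image.2 (hdir.mono' fun _ _ _ _ h => e.symm.monotone h))
    (e.symm.isLUB_image'.2 hb) (e.le_symm_apply.2 hkb)
  exact ⟨x, hx, e.le_symm_apply.1 hkx⟩

/-- The isomorphism in `AlgFrm_J` given by an order isomorphism. -/
def AlgFrmJ.isoOfOrderIso {L M : AlgFrmJ.{u}} (e : L ≃o M) : L ≅ M where
  hom := ⟨e, map_sSup e, fun _ => isCompactElement_map_orderIso e⟩
  inv := ⟨e.symm, map_sSup e.symm, fun _ => isCompactElement_map_orderIso e.symm⟩
  hom_inv_id := AlgFrmJHom.ext (funext e.symm_apply_apply)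
  inv_hom_id := AlgFrmJHom.ext (funext e.apply_symm_apply)

/-- The complete join-semilattice map underlying a morphism of `AlgFrm_J`. -/
def AlgFrmJHom.tosSupHom {L M : AlgFrmJ.{u}} (α : AlgFrmJHom L M) : sSupHom L M :=
  ⟨α.toFun, α.map_sSup⟩

namespace AdmClosedUp

variable {X Y : PGPS.{u}}

theorem mem_iff_forall_adm {C : AdmClosedUp X} {x : X} :
    x ∈ C.carrier ↔ ∀ U ∈ X.adm, C.carrier ⊆ U → x ∈ U := by
  refine ⟨fun hx U _ hCU => hCU hx, fun h => ?_⟩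
  by_contra hxC
  obtain ⟨U, hU, hCU, hxU⟩ := PGPS.exists_adm C hxC
  exact hxU (h U hU hCU)

/-- The relation `R ⊆ X × Y` dual to a map `f` of admissible closed upsets: `R[x]` is the
intersection of all `C` with `x ∈ f(C)`. -/
def dualRel (f : AdmClosedUp Y → AdmClosedUp X) (x : X) (y : Y) : Prop :=
  ∀ C : AdmClosedUp Y, x ∈ (f C).carrier → y ∈ C.carrier

theorem boxRel_dualRel (f : sSupHom (AdmClosedUp Y) (AdmClosedUp X)) (C : AdmClosedUp Y) :
    boxRel (dualRel f) C.carrier = (f C).carrier := by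
  ext x
  refine ⟨fun hx => ?_, fun hx y hy => hy C hx⟩
  have hC : C ≤ sSup {D | x ∈ (f D).carrier} := fun y hy => hx y fun D hD => mem_sSup.1 hy D hD
  have hxf : x ∈ (f (sSup {D | x ∈ (f D).carrier})).carrier := by
    rw [map_sSup, mem_sSup]
    exact Set.forall_mem_image.2 fun D hD => hD
  exact OrderHomClass.mono f hC hxf

end AdmClosedUp

/-- The generalized Priestley morphism dual to a morphism of `AlgFrm_J` between lattices of
admissible closed upsets, inverse to `VaMap`. -/
def GPMor.ofAlgFrmJHom {X Y : PGPS.{u}} (α : AlgFrmJHom (VaObj Y) (VaObj X)) : GPMor X Y where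
  rel := AdmClosedUp.dualRel α.toFun
  sep x y h := by
    obtain ⟨C, hxC, hyC⟩ : ∃ C : AdmClosedUp Y, x ∈ (α.toFun C : AdmClosedUp X).carrier ∧
        y ∉ C.carrier := by
      simpa only [AdmClosedUp.dualRel, not_forall, exists_prop] using h
    obtain ⟨U, hU, hCU, hyU⟩ := PGPS.exists_adm C hyC
    exact ⟨U, hU, fun z hz => hCU (hz C hxC), hyU⟩
  box_mem U hU := by
    have hbox := AdmClosedUp.boxRel_dualRel α.tosSupHom (PGPS.admToClosed hU)
    have hcompact := α.map_compact (PGPS.admToClosed hU) (AdmClosedUp.isCompactElement_iff.2 hU)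
    exact hbox ▸ AdmClosedUp.isCompactElement_iff.1 hcompact

theorem VaMap_ofAlgFrmJHom {X Y : PGPS.{u}} (α : AlgFrmJHom (VaObj Y) (VaObj X)) :
    VaMap (GPMor.ofAlgFrmJHom α) = α :=
  AlgFrmJHom.ext <| funext fun C => AdmClosedUp.ext <|
    AdmClosedUp.boxRel_dualRel α.tosSupHom C

theorem ofAlgFrmJHom_VaMap {X Y : PGPS.{u}} (R : GPMor X Y) : GPMor.ofAlgFrmJHom (VaMap R) = R :=
  GPMor.ext_box fun _ hU => AdmClosedUp.boxRel_dualRel (VaMap R).tosSupHom (PGPS.admToClosed hU)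

/-- `𝒱ᵃ` is fully faithful: every morphism of `AlgFrm_J` between lattices of admissible closed
upsets is `□_R` for a unique `R`, namely its dual relation. -/
def Va.fullyFaithful : Va.{u}.FullyFaithful where
  preimage α := Quiver.Hom.op (GPMor.ofAlgFrmJHom α)
  map_preimage := VaMap_ofAlgFrmJHom
  preimage_map R := congrArg Quiver.Hom.op (ofAlgFrmJHom_VaMap R.unop)

namespace YSet

variable {L M : AlgFrmJ.{u}}

theorem isClosed_up (a : L) : IsClosed (up a) := by
  have h : up a = ⋂ k ∈ {k : L | IsCompactElement k ∧ k ≤ a}, up k := by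
    ext y
    simp only [mem_up, Set.mem_iInter, Set.mem_ofPred_eq, and_imp, le_iff_compact_le_imp (a := a)]
  exact h ▸ isClosed_biInter fun k hk => (isClopen_up hk.1).isClosed

/-- `↑a ∩ Y_L` as an admissible closed upset of `𝒴(L)`. -/
def upClosed (a : L) : AdmClosedUp (YObj L) :=
  AdmClosedUp.mk₁ (X := YObj L) (up a) (isClosed_up a) (isUpperSet_up a) fun _ hy =>
    let ⟨_, hp, hyp, hap⟩ := exists_prime hy
    ⟨ofPrime hp, hp, hap, hyp⟩

theorem upClosed_le_upClosed {a b : L} : upClosed a ≤ upClosed b ↔ a ≤ b :=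
  up_subset_iff

theorem upClosed_surjective : Function.Surjective (upClosed (L := L)) := by
  refine fun C => ⟨sSup {k | IsCompactElement k ∧ C.carrier ⊆ up k}, AdmClosedUp.ext ?_⟩
  refine Set.ext fun (y : YSet L) => ?_
  calc y ∈ up (sSup {k : L | IsCompactElement k ∧ C.carrier ⊆ up k})
    _ ↔ ∀ k : L, IsCompactElement k → C.carrier ⊆ up k → y ∈ up k := by
      simp only [mem_up, sSup_le_iff, Set.mem_ofPred_eq, and_imp]
    _ ↔ ∀ U ∈ (YObj L).adm, C.carrier ⊆ U → y ∈ U := by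
      refine ⟨fun h U hU hCU => ?_, fun h k hk => h (up k) (up_mem_adm hk)⟩
      obtain ⟨k, hk, rfl⟩ := adm_iff.1 hU
      exact h k hk hCU
    _ ↔ y ∈ C.carrier := AdmClosedUp.mem_iff_forall_adm.symm

/-- The order isomorphism `a ↦ ↑a ∩ Y_L` of `L` onto `𝒱ᵃ(𝒴(L))`. -/
noncomputable def upOrderIso (L : AlgFrmJ.{u}) : L ≃o VaObj (YObj L) :=
  RelIso.ofSurjective
    (OrderEmbedding.ofMapLEIff (β := AdmClosedUp (YObj L)) upClosed fun _ _ => upClosed_le_upClosed)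
    upClosed_surjective

theorem boxClosed_YMap_upClosed (α : AlgFrmJHom L M) (a : L) :
    boxClosed (YMap α) (upClosed a) = upClosed (α.toFun a) :=
  AdmClosedUp.ext (boxRel_YRel α a)

end YSet

/-- The natural isomorphism of `𝒱ᵃ ∘ 𝒴` with the identity, with components `↑a ∩ Y_L ↦ a`. It
lives in `AlgFrm_Jᵒᵖ`, so its homs are opposites of the maps `a ↦ ↑a ∩ Y_L`. -/
noncomputable def YfunCompVaIso : Yfun.{u} ⋙ Va.{u}.rightOp ≅ 𝟭 AlgFrmJ.{u}ᵒᵖ :=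
  NatIso.ofComponents (fun L => (AlgFrmJ.isoOfOrderIso (YSet.upOrderIso L.unop)).op) fun α =>
    Quiver.Hom.unop_inj <| AlgFrmJHom.ext <| funext <| YSet.boxClosed_YMap_upClosed α.unop

theorem mainTheorem1 :
    ∃ e : AlgFrmJ.{u}ᵒᵖ ≌ PGPS.{u}, e.functor = Yfun.{u} ∧ e.inverse = Va.{u}.rightOp :=
  ⟨equivalenceOfFullyFaithful Va.fullyFaithful.rightOp YfunCompVaIso, rfl, rfl⟩
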